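/- A *body* is a bounded connected closed set $B\subset\mathbb R^3$ that is the closure of its interior and has piecewise smooth boundary. Consider the billiard in $\mathbb R^3\setminus B$: a particle moves freely outside $B$ and is reflected elastically at smooth points of $\partial B$. If a particle moves as $x+vt$ for $t$ near $-\infty$ and, after finitely many (maybe no) reflections, as $x^++v^+t$ for $t$ near $+\infty$, write $x_B^+(x,v)=x^+$, $v_B^+(x,v)=v^+$ and $\tilde x_B^+(x,v)=x^+-\langle x^+,v^+\rangle v^+$. For a unit vector $v_0$, the body $B$ is *invisible in the direction $v_0$* if $v_B^+(x,v_0)$ is defined and equal to $v_0$ for almost every $x\in\mathbb R^3$; the map $x\mapsto\tilde x_B^+(x,v_0)$ is defined almost everywhere on the plane $\{v_0\}^\perp$ and preserves the two-dimensional Lebesgue measure there; and $\tilde x_B^+(x,v_0)=x$ for almost every $x\in\{v_0\}^\perp$. A body $B$ is *inscribed* in the cylinder $\Omega\times[0,h]$, where $\Omega\subset\mathbb R^2$, if $B\subset\Omega\times[0,h]$ and $\Omega\times\{c\}\subset B$ for some $c\in[0,h]$. **Theorem.** Let $0<r<1$ and let $\Omega=\{(x_1,x_2): r^2\le x_1^2+x_2^2\le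 1\}$. There is a number $h_0$, depending on $r$, such that for every $h\ge h_0$ there exists a body inscribed in $\Omega\times[0,h]$ and invisible in the direction $v_0=(0,0,-1)$. -/

import Mathlib

open Set Filter Topology MeasureTheory
open scoped ContDiff

/-- Euclidean three-dimensional space. -/
abbrev E3 : Type := EuclideanSpace ℝ (Fin 3)

/-- Euclidean plane. -/
abbrev E2 : Type := EuclideanSpace ℝ (Fin 2)

/-! ### Bodies -/

/-- The closed unit square (parameter domain of a surface patch). -/
def closedSquare : Set (ℝ × ℝ) := Icc (0 : ℝ) 1 ×ˢ Icc (0 : ℝ) 1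

/-- The open unit square. -/
def openSquare : Set (ℝ × ℝ) := Ioo (0 : ℝ) 1 ×ˢ Ioo (0 : ℝ) 1

/-- `φ` parametrizes a compact regular smooth (i.e. `C^∞`) surface patch: it is smooth, and on the
closed unit square it is injective and has a derivative of rank two. -/
structure IsSmoothPatch (φ : ℝ × ℝ → E3) : Prop where
  contDiff : ContDiff ℝ ∞ φ
  injOn : InjOn φ closedSquare
  regular : ∀ p ∈ closedSquare, Function.Injective (fderiv ℝ φ p)

/-- The boundary of `B` is piecewise smooth: it is a finite union of compact regular smooth surface
patches, and distinct patches can meet only along their edges. -/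
def HasPiecewiseSmoothBoundary (B : Set E3) : Prop :=
  ∃ (ι : Type) (_ : Finite ι) (φ : ι → ℝ × ℝ → E3),
    (∀ i, IsSmoothPatch (φ i)) ∧
    frontier B = ⋃ i, φ i '' closedSquare ∧
    ∀ i j, i ≠ j → Disjoint (φ i '' closedSquare) (φ j '' openSquare)

/-- A body: a bounded connected (in particular nonempty) set with piecewise smooth boundary, which
moreover is a closed solid, that is, the closure of its interior. -/
structure IsBody (B : Set E3) : Prop where
  bounded : Bornology.IsBounded B
  connected : IsConnected B
  solid : closure (interior B) = B
  boundary : HasPiecewiseSmoothBoundary B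

/-! ### The billiard outside a body -/

/-- `p` is a smooth boundary point of `B`, and `n` is the outward unit normal there: near `p` the
set `B` is given by `g ≤ 0`, where `g` is smooth, vanishes at `p`, and has gradient `n` at `p`,
with `‖n‖ = 1`. -/
def IsOutwardNormal (B : Set E3) (p n : E3) : Prop :=
  ‖n‖ = 1 ∧ ∃ (U : Set E3) (g : E3 → ℝ), IsOpen U ∧ p ∈ U ∧ ContDiffOn ℝ ∞ g U ∧
    g p = 0 ∧ HasGradientAt g n p ∧ ∀ y ∈ U, (y ∈ B ↔ g y ≤ 0)

/-- Elastic reflection of the velocity `v` from a surface with unit normal `n`. -/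
noncomputable def reflectVel (n v : E3) : E3 := v - (2 * inner ℝ v n) • n

/-- `FinalMotion B a x v x' v'`: a billiard particle in the complement of `B` which, immediately
after the time `a` (`a = ⊥` stands for `-∞`), moves as `x + t v`, makes finitely many (maybe no)
further elastic reflections from smooth points of the boundary of `B`, and finally moves freely as
`x' + t v'`. The argument `t` is the absolute time throughout. -/
inductive FinalMotion (B : Set E3) : WithBot ℝ → E3 → E3 → E3 → E3 → Prop
  /-- The particle does not hit `B` any more. -/
  | free (a : WithBot ℝ) (x v : E3)
      (hfree : ∀ t : ℝ, a < (t : WithBot ℝ) → x + t • v ∉ B) :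
      FinalMotion B a x v x v
  /-- The particle moves freely until the time `τ`, when it hits, transversally and from outside,
  the boundary of `B` at a smooth point with outward normal `n`; its motion then becomes
  `x + τ v + (t - τ) (reflectVel n v)`. -/
  | reflect (a : WithBot ℝ) (x v x' v' : E3) (τ : ℝ) (n : E3)
      (hτ : a < (τ : WithBot ℝ))
      (hfree : ∀ t : ℝ, a < (t : WithBot ℝ) → t < τ → x + t • v ∉ B)
      (hn : IsOutwardNormal B (x + τ • v) n)
      (hv : inner ℝ v n < 0)
      (hnext : FinalMotion B (τ : WithBot ℝ)
        (x + τ • v - τ • reflectVel n v) (reflectVel n v) x' v') :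
      FinalMotion B a x v x' v'

/-- The graph of the scattering map `(x, v) ↦ (x⁺, v⁺)` of the body `B`: a billiard particle in the
complement of `B` which moves as `x + t v` for all `t` close to `-∞` moves as `x⁺ + t v⁺` for all
`t` close to `+∞`. -/
def Scatters (B : Set E3) (x v x' v' : E3) : Prop := FinalMotion B ⊥ x v x' v'

theorem IsOutwardNormal.mem {B : Set E3} {p n : E3} (h : IsOutwardNormal B p n) : p ∈ B := by
  obtain ⟨-, U, g, -, hp, -, hg, -, hB⟩ := h
  exact (hB p hp).2 hg.le

/-- The outward normal at a smooth boundary point is unique. -/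
theorem IsOutwardNormal.unique {B : Set E3} {p n m : E3} (h : IsOutwardNormal B p n)
    (h' : IsOutwardNormal B p m) : n = m := by
  obtain ⟨hn, U, g, hU, hpU, -, hg, hgn, hB⟩ := h
  obtain ⟨hm, V, k, hV, hpV, -, hk, hkm, hC⟩ := h'
  by_contra hne
  have hlt : inner ℝ n m < (1 : ℝ) := (inner_lt_one_iff_real_of_norm_eq_one hn hm).2 hne
  -- along the ray `p + s (n - m)`, the function `g` increases and `k` decreases
  have hline : HasDerivAt (fun s : ℝ => p + s • (n - m)) (n - m) 0 := by
    simpa using ((hasDerivAt_id (0 : ℝ)).smul_const (n - m)).const_add p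
  have key : ∀ (f : E3 → ℝ) (w : E3), HasGradientAt f w p →
      HasDerivAt (fun s : ℝ => f (p + s • (n - m))) (inner ℝ w (n - m)) 0 := by
    intro f w hf
    have h1 : HasFDerivAt f (InnerProductSpace.toDual ℝ E3 w) (p + (0 : ℝ) • (n - m)) := by
      simpa using hf.hasFDerivAt
    have h2 := h1.comp_hasDerivAt (0 : ℝ) hline
    rw [InnerProductSpace.toDual_apply_apply] at h2
    exact h2
  have hgd := key g n hgn
  have hkd := key k m hkm
  have hnn : inner ℝ n n = (1 : ℝ) := by rw [real_inner_self_eq_norm_sq, hn]; norm_num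
  have hmm : inner ℝ m m = (1 : ℝ) := by rw [real_inner_self_eq_norm_sq, hm]; norm_num
  have hg1 : (0 : ℝ) < inner ℝ n (n - m) := by rw [inner_sub_right, hnn]; linarith
  have hk1 : inner ℝ m (n - m) < (0 : ℝ) := by
    rw [inner_sub_right, hmm, real_inner_comm]; linarith
  have hcont : Tendsto (fun s : ℝ => p + s • (n - m)) (𝓝[>] 0) (𝓝 p) := by
    have := hline.continuousAt.tendsto
    simp only [zero_smul, add_zero] at this
    exact this.mono_left nhdsWithin_le_nhds
  have e1 : ∀ᶠ s in 𝓝[>] (0 : ℝ), 0 < g (p + s • (n - m)) := by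
    have := (hasDerivAt_iff_tendsto_slope.1 hgd).mono_left
      (nhdsWithin_mono 0 (fun s (hs : s ∈ Ioi (0 : ℝ)) => (ne_of_gt hs)))
    filter_upwards [this.eventually (lt_mem_nhds hg1), self_mem_nhdsWithin] with s hs hs0
    simp only [slope_def_field, zero_smul, add_zero, hg, sub_zero] at hs
    exact (div_pos_iff_of_pos_right hs0).1 hs
  have e2 : ∀ᶠ s in 𝓝[>] (0 : ℝ), k (p + s • (n - m)) < 0 := by
    have := (hasDerivAt_iff_tendsto_slope.1 hkd).mono_left
      (nhdsWithin_mono 0 (fun s (hs : s ∈ Ioi (0 : ℝ)) => (ne_of_gt hs)))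
    filter_upwards [this.eventually (gt_mem_nhds hk1), self_mem_nhdsWithin] with s hs hs0
    simp only [slope_def_field, zero_smul, add_zero, hk, sub_zero] at hs
    exact (div_neg_iff.1 hs).elim (fun h => absurd h.2 (not_lt.2 (le_of_lt hs0))) (fun h => h.1)
  obtain ⟨s, h1, h2, h3, h4⟩ := (e1.and (e2.and ((hcont.eventually (hU.mem_nhds hpU)).and
    (hcont.eventually (hV.mem_nhds hpV))))).exists
  exact absurd ((hB _ h3).1 ((hC _ h4).2 h2.le)) (not_le.2 h1)

/-- The final motion is determined by the initial one, so that `Scatters B` is indeed the graph of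
a (partially defined) map. -/
theorem FinalMotion.unique {B : Set E3} {a : WithBot ℝ} {x v x₁ v₁ x₂ v₂ : E3}
    (h₁ : FinalMotion B a x v x₁ v₁) (h₂ : FinalMotion B a x v x₂ v₂) : x₁ = x₂ ∧ v₁ = v₂ := by
  induction h₁ with
  | free a x v hfree =>
    cases h₂ with
    | free => exact ⟨rfl, rfl⟩
    | reflect _ _ _ _ _ τ n hτ _ hn => exact absurd hn.mem (hfree τ hτ)
  | reflect a x v x' v' τ n hτ hfree hn hv hnext ih =>
    cases h₂ with
    | free _ _ _ hfree' => exact absurd hn.mem (hfree' τ hτ)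
    | reflect _ _ _ _ _ σ m hσ hfree' hm hw hnext' =>
      obtain rfl : τ = σ := by
        rcases lt_trichotomy τ σ with h | h | h
        · exact absurd hn.mem (hfree' τ hτ h)
        · exact h
        · exact absurd hm.mem (hfree σ hσ h)
      obtain rfl := hn.unique hm
      exact ih hnext'

/-! ### Zero resistance, no trace, invisibility -/

/-- The component of `x'` orthogonal to the unit vector `v'`. -/
noncomputable def perpPart (x' v' : E3) : E3 := x' - (inner ℝ x' v' : ℝ) • v'

/-- `B` has zero resistance in the direction `v`: for almost every `x`, the final velocity is
defined and equals `v`. -/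
def HasZeroResistance (B : Set E3) (v : E3) : Prop :=
  ∀ᵐ x : E3, ∃ x' v', Scatters B x v x' v' ∧ v' = v

/-- `B` leaves no trace in the direction `v`: it has zero resistance, and the map sending `x` to
the component of `x⁺ (x, v)` orthogonal to `v⁺ (x, v)` is defined almost everywhere in the plane
`v^⊥` and preserves the two-dimensional Lebesgue measure there. -/
def LeavesNoTrace (B : Set E3) (v : E3) : Prop :=
  HasZeroResistance B v ∧
    ∃ f : (ℝ ∙ v)ᗮ → (ℝ ∙ v)ᗮ, MeasurePreserving f volume volume ∧
      ∀ᵐ x : (ℝ ∙ v)ᗮ, ∃ x' v', Scatters B (x : E3) v x' v' ∧ perpPart x' v' = (f x : E3)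

/-- `B` is invisible in the direction `v`: it leaves no trace, and the map above is the identity
almost everywhere. -/
def IsInvisible (B : Set E3) (v : E3) : Prop :=
  LeavesNoTrace B v ∧
    ∀ᵐ x : (ℝ ∙ v)ᗮ, ∃ x' v', Scatters B (x : E3) v x' v' ∧ perpPart x' v' = (x : E3)

/-! ### Bodies inscribed in a cylinder -/

/-- The cylinder `Ω × I` in the coordinates `(x₁, x₂, x₃)` of space. -/
def cylinder (Ω : Set E2) (I : Set ℝ) : Set E3 := {x | !₂[x 0, x 1] ∈ Ω ∧ x 2 ∈ I}

/-- `B` is inscribed in the cylinder `Ω × [0, h]`: it is contained in the cylinder and contains a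
cross section `Ω × {c}` with `c ∈ [0, h]`. -/
def IsInscribed (Ω : Set E2) (h : ℝ) (B : Set E3) : Prop :=
  B ⊆ cylinder Ω (Icc 0 h) ∧ ∃ c ∈ Icc (0 : ℝ) h, cylinder Ω {c} ⊆ B

/-- The ring `r² ≤ x₁² + x₂² ≤ 1` in the plane. -/
def planarRing (r : ℝ) : Set E2 := {y | r ^ 2 ≤ y 0 ^ 2 + y 1 ^ 2 ∧ y 0 ^ 2 + y 1 ^ 2 ≤ 1}

/-!
# A body inscribed in a ring cylinder and invisible in the vertical direction

Take the paraboloids of revolution `z - c = ± (ρ² - r²) / (2 r)`. They meet on the circle `ρ = r`,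
`z = c`, and have the same focus `(0, 0, c)` on the axis. The part of the unit cylinder between them
is a solid ring with the cross section `Ω × {c}`. A particle that falls vertically onto the
upper paraboloid at horizontal distance `r < ρ < 1` from the axis is sent through the focus, and
from there, by the central symmetry of the ring about the focus, to the antipodal point of the lower
paraboloid, which makes its velocity vertical again. On the way it does not meet the ring
(`focal_chord_notMem`). So one ring acts on vertical trajectories as the half turn
`(x₁, x₂) ↦ (-x₁, -x₂)` (`FinalMotion.cross_ring`), and two rings on top of each other act as the
identity (`scatters_of_lt_of_lt`). Particles with `ρ < r` or `ρ > 1` miss the body, and the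
cylinders `ρ = r` and `ρ = 1` are null sets because they lie in frontiers of convex sets
(`addHaar_preimage_sphere`).

The two rings, of height `2 * halfHeight r` each, touch along the upper rim of the one and the lower
rim of the other, so that their union `doubleRing r` is connected. Its boundary consists of the
mirrors and the outer walls, which are surfaces of revolution and meet only along their edges
(`frontier_doubleRing`, `disjoint_boundaryPatch`). A body inscribed in `Ω × [0, h]` need not reach
the height `h`, so the same body serves every `h ≥ 4 * halfHeight r`.
-/

/-! ### The body -/

/-- Squared distance of `x` from the vertical axis. -/
def axisDistSq (x : E3) : ℝ := x 0 ^ 2 + x 1 ^ 2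

/-- Half the height of one mirror ring. -/
noncomputable def halfHeight (r : ℝ) : ℝ := (1 - r ^ 2) / (2 * r)

/-- The solid ring inside the unit cylinder that is bounded above and below by the paraboloids of
revolution `z - c = ± (ρ² - r²) / (2 r)`, which have their common focus at the point `(0, 0, c)`.
The condition `r ≤ ρ` is implied, as the two paraboloids meet on the circle `ρ = r`. -/
def mirrorRing (r c : ℝ) : Set E3 :=
  {x | axisDistSq x ≤ 1 ∧ 2 * r * |x 2 - c| ≤ axisDistSq x - r ^ 2}

/-- Two mirror rings, one on top of the other, touching along a circle of radius one. -/
noncomputable def doubleRing (r : ℝ) : Set E3 :=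
  mirrorRing r (halfHeight r) ∪ mirrorRing r (3 * halfHeight r)

/-- The two heights at which the foci of `doubleRing r` lie. -/
def IsFocusHeight (r c : ℝ) : Prop := c = halfHeight r ∨ c = 3 * halfHeight r

theorem two_mul_halfHeight {r : ℝ} (hr0 : 0 < r) : 2 * r * halfHeight r = 1 - r ^ 2 := by
  unfold halfHeight; field_simp

theorem halfHeight_pos {r : ℝ} (hr0 : 0 < r) (hr1 : r < 1) : 0 < halfHeight r := by
  unfold halfHeight
  have : 0 < 1 - r ^ 2 := by nlinarith
  positivity

theorem mirrorRing_subset_doubleRing {r c : ℝ} (hc : IsFocusHeight r c) :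
    mirrorRing r c ⊆ doubleRing r := by
  rcases hc with rfl | rfl
  · exact subset_union_left
  · exact subset_union_right

theorem mem_doubleRing_iff {r : ℝ} {x : E3} :
    x ∈ doubleRing r ↔ ∃ c, IsFocusHeight r c ∧ x ∈ mirrorRing r c := by
  constructor
  · rintro (h | h)
    exacts [⟨_, Or.inl rfl, h⟩, ⟨_, Or.inr rfl, h⟩]
  · rintro ⟨c, hc, h⟩
    exact mirrorRing_subset_doubleRing hc h

theorem abs_sub_le_of_mem_mirrorRing {r c : ℝ} (hr0 : 0 < r) {x : E3} (h : x ∈ mirrorRing r c) :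
    |x 2 - c| ≤ halfHeight r := by
  have h1 := two_mul_halfHeight hr0
  have : 2 * r * |x 2 - c| ≤ 2 * r * halfHeight r := by linarith [h.1, h.2]
  exact le_of_mul_le_mul_left this (by positivity)

theorem IsFocusHeight.two_mul_le_abs {r c c' : ℝ} (hr0 : 0 < r) (hr1 : r < 1)
    (hc : IsFocusHeight r c) (hc' : IsFocusHeight r c') (hne : c ≠ c') :
    2 * halfHeight r ≤ |c - c'| := by
  have hG := halfHeight_pos hr0 hr1
  rcases hc with rfl | rfl <;> rcases hc' with rfl | rfl
  · exact absurd rfl hne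
  · rw [abs_sub_comm]; exact le_abs.2 (Or.inl (by linarith))
  · exact le_abs.2 (Or.inl (by linarith))
  · exact absurd rfl hne

/-- In the open horizontal layer around one of the rings the other ring is not seen. -/
theorem mem_doubleRing_iff_of_abs_lt {r c : ℝ} (hr0 : 0 < r) (hr1 : r < 1)
    (hc : IsFocusHeight r c) {x : E3} (hx : |x 2 - c| < halfHeight r) :
    x ∈ doubleRing r ↔ x ∈ mirrorRing r c := by
  refine ⟨fun h => ?_, fun h => mirrorRing_subset_doubleRing hc h⟩
  obtain ⟨c', hc', h'⟩ := mem_doubleRing_iff.1 h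
  by_cases hne : c = c'
  · rwa [hne]
  · have h1 := abs_sub_le_of_mem_mirrorRing hr0 h'
    have h2 := hc.two_mul_le_abs hr0 hr1 hc' hne
    have h3 := abs_sub_le c (x 2) c'
    rw [abs_sub_comm c (x 2)] at h3
    linarith

theorem continuous_axisDistSq : Continuous axisDistSq := by
  unfold axisDistSq; fun_prop

theorem isClosed_mirrorRing (r c : ℝ) : IsClosed (mirrorRing r c) := by
  have := continuous_axisDistSq
  exact (isClosed_le this continuous_const).inter
    (isClosed_le (f := fun x : E3 => 2 * r * |x 2 - c|) (by fun_prop) (by fun_prop))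

theorem isClosed_doubleRing (r : ℝ) : IsClosed (doubleRing r) :=
  (isClosed_mirrorRing _ _).union (isClosed_mirrorRing _ _)

theorem sq_le_axisDistSq_of_mem {r c : ℝ} (hr0 : 0 < r) {x : E3} (h : x ∈ mirrorRing r c) :
    r ^ 2 ≤ axisDistSq x := by
  have : 0 ≤ 2 * r * |x 2 - c| := by positivity
  linarith [h.2]

theorem axisDistSq_le_one_of_mem {r : ℝ} {x : E3} (h : x ∈ doubleRing r) : axisDistSq x ≤ 1 :=
  h.elim (fun h => h.1) (fun h => h.1)

theorem sq_le_axisDistSq_of_mem_doubleRing {r : ℝ} (hr0 : 0 < r) {x : E3}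
    (h : x ∈ doubleRing r) : r ^ 2 ≤ axisDistSq x :=
  h.elim (sq_le_axisDistSq_of_mem hr0) (sq_le_axisDistSq_of_mem hr0)

theorem mem_Icc_of_mem_doubleRing {r : ℝ} (hr0 : 0 < r) {x : E3} (h : x ∈ doubleRing r) :
    x 2 ∈ Icc 0 (4 * halfHeight r) := by
  rcases h with h | h <;>
  · have := abs_le.1 (abs_sub_le_of_mem_mirrorRing hr0 h)
    have := (abs_nonneg _).trans (abs_sub_le_of_mem_mirrorRing hr0 h)
    constructor <;> linarith

theorem isInscribed_doubleRing {r h : ℝ} (hr0 : 0 < r) (hr1 : r < 1)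
    (hh : 4 * halfHeight r ≤ h) : IsInscribed (planarRing r) h (doubleRing r) := by
  have hG := halfHeight_pos hr0 hr1
  refine ⟨fun x hx => ⟨⟨?_, ?_⟩, ?_⟩, halfHeight r, ⟨hG.le, by linarith⟩, ?_⟩
  · simpa [axisDistSq] using sq_le_axisDistSq_of_mem_doubleRing hr0 hx
  · simpa [axisDistSq] using axisDistSq_le_one_of_mem hx
  · exact Icc_subset_Icc_right hh (mem_Icc_of_mem_doubleRing hr0 hx)
  · rintro x ⟨⟨h1, h2⟩, h3⟩
    rw [mem_singleton_iff] at h3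
    refine Or.inl ⟨by simpa [axisDistSq] using h2, ?_⟩
    have : r ^ 2 ≤ axisDistSq x := by simpa [axisDistSq] using h1
    simpa [h3] using this

theorem isBounded_doubleRing {r : ℝ} (hr0 : 0 < r) : Bornology.IsBounded (doubleRing r) := by
  refine (Metric.isBounded_closedBall (x := (0 : E3)) (r := 1 + 4 * halfHeight r)).subset ?_
  intro x hx
  have h1 := axisDistSq_le_one_of_mem hx
  obtain ⟨h2, h3⟩ := mem_Icc_of_mem_doubleRing hr0 hx
  rw [mem_closedBall_zero_iff, EuclideanSpace.norm_eq, Fin.sum_univ_three]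
  refine Real.sqrt_le_iff.2 ⟨by linarith, ?_⟩
  simp only [Real.norm_eq_abs, sq_abs]
  unfold axisDistSq at h1
  nlinarith

/-! ### Interior and closure -/

/-- The interior is described by the strict inequalities: a point where one of them is an equality
leaves the body under a small horizontal dilation or contraction. -/
theorem mem_interior_doubleRing_iff {r : ℝ} (hr0 : 0 < r) {x : E3} :
    x ∈ interior (doubleRing r) ↔ axisDistSq x < 1 ∧
      ∃ c, IsFocusHeight r c ∧ 2 * r * |x 2 - c| < axisDistSq x - r ^ 2 := by
  have hcont := continuous_axisDistSq
  constructor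
  · intro hx
    have hu : 0 < axisDistSq x := lt_of_lt_of_le (by positivity)
      (sq_le_axisDistSq_of_mem_doubleRing hr0 (interior_subset hx))
    have hk : ∀ k : ℝ, axisDistSq !₂[k * x 0, k * x 1, x 2] = k ^ 2 * axisDistSq x := by
      intro k; simp [axisDistSq]; ring
    have ht : Tendsto (fun k : ℝ => (!₂[k * x 0, k * x 1, x 2] : E3)) (𝓝 1) (𝓝 x) := by
      have : Continuous (fun k : ℝ => (!₂[k * x 0, k * x 1, x 2] : E3)) := by fun_prop
      have h := this.tendsto 1
      convert h using 2
      ext i; fin_cases i <;> simp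
    have hev := ht.eventually (isOpen_interior.mem_nhds hx)
    constructor
    · obtain ⟨k, hk1, hk2⟩ :=
        ((hev.filter_mono nhdsWithin_le_nhds).and (self_mem_nhdsWithin (s := Ioi (1 : ℝ)))).exists
      have h := axisDistSq_le_one_of_mem (interior_subset hk1)
      rw [hk] at h
      have : 1 < k ^ 2 := by have : 1 < k := hk2; nlinarith
      nlinarith
    · have h01 : Ioo (0 : ℝ) 1 ∈ 𝓝[<] (1 : ℝ) := Ioo_mem_nhdsLT one_pos
      obtain ⟨k, hk1, hk2, hk3⟩ :=
        ((hev.filter_mono nhdsWithin_le_nhds).and h01).exists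
      obtain ⟨c, hc, -, h⟩ := mem_doubleRing_iff.1 (interior_subset hk1)
      refine ⟨c, hc, ?_⟩
      rw [hk] at h
      have : k ^ 2 < 1 := by nlinarith
      have h' : 2 * r * |x 2 - c| ≤ k ^ 2 * axisDistSq x - r ^ 2 := by simpa using h
      nlinarith
  · rintro ⟨h1, c, hc, h2⟩
    refine mem_interior.2 ⟨{y | axisDistSq y < 1} ∩
      {y | 2 * r * |y 2 - c| < axisDistSq y - r ^ 2}, ?_, ?_, h1, h2⟩
    · exact fun y hy => mirrorRing_subset_doubleRing hc ⟨hy.1.le, hy.2.le⟩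
    · exact (isOpen_lt hcont continuous_const).inter
        (isOpen_lt (f := fun y : E3 => 2 * r * |y 2 - c|) (by fun_prop) (by fun_prop))

/-- In the coordinates `(ρ², z)` a ring is a triangle, and the segment from any of its points to a
fixed interior point consists of interior points. -/
theorem closure_interior_doubleRing {r : ℝ} (hr0 : 0 < r) (hr1 : r < 1) :
    closure (interior (doubleRing r)) = doubleRing r := by
  refine Subset.antisymm ((isClosed_doubleRing r).closure_subset_iff.2 interior_subset) ?_
  intro x hx
  obtain ⟨c, hc, h1, h2⟩ := mem_doubleRing_iff.1 hx
  have hu : 0 < axisDistSq x := lt_of_lt_of_le (by positivity)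
      (sq_le_axisDistSq_of_mem_doubleRing hr0 hx)
  have hr2 : r ^ 2 < 1 := by nlinarith
  set u := axisDistSq x with hu_def
  set m : ℝ := (1 + r ^ 2) / 2 with hm
  let k : ℝ → ℝ := fun ε => √(1 - ε + ε * (m / u))
  have hcont : Continuous (fun ε : ℝ =>
      (!₂[k ε * x 0, k ε * x 1, c + (1 - ε) * (x 2 - c)] : E3)) := by fun_prop
  have ht : Tendsto (fun ε : ℝ => (!₂[k ε * x 0, k ε * x 1, c + (1 - ε) * (x 2 - c)] : E3))
      (𝓝[>] 0) (𝓝 x) := by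
    have h := (hcont.tendsto 0).mono_left (nhdsWithin_le_nhds (s := Ioi 0))
    convert h using 2
    ext i; fin_cases i <;> simp [k]
  refine mem_closure_of_tendsto ht ?_
  filter_upwards [Ioo_mem_nhdsGT (one_pos : (0 : ℝ) < 1)] with ε hε
  have hk : axisDistSq !₂[k ε * x 0, k ε * x 1, c + (1 - ε) * (x 2 - c)] =
      (1 - ε) * u + ε * m := by
    have h0 : 0 ≤ 1 - ε + ε * (m / u) := by
      have := hε.1; have := hε.2; have : 0 < m / u := by positivity
      nlinarith
    have : (k ε) ^ 2 = 1 - ε + ε * (m / u) := Real.sq_sqrt h0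
    calc _ = (k ε) ^ 2 * u := by simp [axisDistSq, hu_def]; ring
      _ = _ := by rw [this]; field_simp
  rw [mem_interior_doubleRing_iff hr0, hk]
  refine ⟨by nlinarith [hε.1, hε.2], c, hc, ?_⟩
  have h3 : |(c + (1 - ε) * (x 2 - c)) - c| = (1 - ε) * |x 2 - c| := by
    rw [add_sub_cancel_left, abs_mul, abs_of_pos (by linarith [hε.2])]
  have h4 : 2 * r * |(c + (1 - ε) * (x 2 - c)) - c| < (1 - ε) * u + ε * m - r ^ 2 := by
    rw [h3]
    nlinarith [hε.1, hε.2, mul_le_mul_of_nonneg_left h2 (sub_nonneg.2 hε.2.le)]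
  simpa using h4

/-! ### Connectedness -/

/-- The sign `1` or `-1`, used to index the two halves of a surface of revolution and its upper and
lower parts. -/
def boolSign (b : Bool) : ℝ := if b then 1 else -1

theorem boolSign_sq (b : Bool) : boolSign b ^ 2 = 1 := by
  cases b <;> norm_num [boolSign]

theorem exists_half_turn_polar {a b ρ : ℝ} (hρ : 0 < ρ) (h : a ^ 2 + b ^ 2 = ρ ^ 2) :
    ∃ σ : Bool, ∃ t ∈ Icc (0 : ℝ) 1,
      a = boolSign σ * (ρ * Real.cos (Real.pi * t)) ∧
      b = boolSign σ * (ρ * Real.sin (Real.pi * t)) := by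
  obtain ⟨σ, hσ⟩ : ∃ σ : Bool, 0 ≤ boolSign σ * b := by
    rcases le_total 0 b with hb | hb
    · exact ⟨true, by simpa [boolSign] using hb⟩
    · exact ⟨false, by simpa [boolSign] using hb⟩
  have hs := boolSign_sq σ
  have hab : |a| ≤ ρ := abs_le_of_sq_le_sq (by nlinarith [sq_nonneg b]) hρ.le
  have hy : |boolSign σ * a / ρ| ≤ 1 := by
    rw [abs_div, abs_mul, abs_of_pos hρ, div_le_one hρ]
    have : |boolSign σ| = 1 := by
      cases σ <;> simp [boolSign]
    rwa [this, one_mul]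
  obtain ⟨hy1, hy2⟩ := abs_le.1 hy
  have hpi := Real.pi_pos
  refine ⟨σ, Real.arccos (boolSign σ * a / ρ) / Real.pi,
    ⟨by have := Real.arccos_nonneg (boolSign σ * a / ρ); positivity,
      (div_le_one hpi).2 (Real.arccos_le_pi _)⟩, ?_⟩
  rw [mul_div_cancel₀ _ hpi.ne', Real.cos_arccos hy1 hy2, Real.sin_arccos]
  have hsq : √(1 - (boolSign σ * a / ρ) ^ 2) = boolSign σ * b / ρ := by
    rw [← Real.sqrt_sq (show 0 ≤ boolSign σ * b / ρ by positivity)]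
    congr 1
    field_simp
    rw [hs]; linarith
  rw [hsq, mul_div_cancel₀ _ hρ.ne', mul_div_cancel₀ _ hρ.ne', ← mul_assoc, ← mul_assoc, ← sq, hs]
  simp

theorem isConnected_mirrorRing {r : ℝ} (hr0 : 0 < r) (hr1 : r < 1) (c : ℝ) :
    IsConnected (mirrorRing r c) := by
  let f : ℝ × ℝ × ℝ → E3 := fun p =>
    !₂[p.1 * Real.cos p.2.2, p.1 * Real.sin p.2.2, c + p.2.1 * (p.1 ^ 2 - r ^ 2) / (2 * r)]
  have hf : Continuous f := by fun_prop
  have hdom : IsConnected (Icc r 1 ×ˢ (Icc (-1 : ℝ) 1 ×ˢ (univ : Set ℝ))) :=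
    (isConnected_Icc hr1.le).prod ((isConnected_Icc (by norm_num)).prod isConnected_univ)
  suffices h : mirrorRing r c = f '' (Icc r 1 ×ˢ (Icc (-1 : ℝ) 1 ×ˢ (univ : Set ℝ))) by
    rw [h]; exact hdom.image f hf.continuousOn
  ext x
  constructor
  · intro hx
    have h1 := sq_le_axisDistSq_of_mem hr0 hx
    obtain ⟨h2, h3⟩ := hx
    have hu0 : 0 ≤ axisDistSq x := (sq_nonneg r).trans h1
    have hρ : r ≤ √(axisDistSq x) := Real.le_sqrt_of_sq_le h1
    obtain ⟨σ, t, -, ht⟩ := exists_half_turn_polar (hr0.trans_le hρ)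
      (show x 0 ^ 2 + x 1 ^ 2 = √(axisDistSq x) ^ 2 from (Real.sq_sqrt hu0).symm)
    obtain ⟨θ, h4, h5⟩ : ∃ θ, x 0 = √(axisDistSq x) * Real.cos θ ∧
        x 1 = √(axisDistSq x) * Real.sin θ := by
      cases σ
      · exact ⟨Real.pi * t + Real.pi, by simp [ht, boolSign], by simp [ht, boolSign]⟩
      · exact ⟨Real.pi * t, by simp [ht, boolSign], by simp [ht, boolSign]⟩
    obtain ⟨s, hs, hs'⟩ : ∃ s ∈ Icc (-1 : ℝ) 1,
        2 * r * (x 2 - c) = s * (axisDistSq x - r ^ 2) := by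
      rcases (sub_nonneg.2 h1).eq_or_lt with h0 | h0
      · refine ⟨0, by norm_num, ?_⟩
        have : |2 * r * (x 2 - c)| ≤ 0 := by
          rw [abs_mul, abs_of_pos (by positivity)]; linarith
        simpa using abs_nonpos_iff.1 this
      · refine ⟨2 * r * (x 2 - c) / (axisDistSq x - r ^ 2), ?_, by field_simp⟩
        rw [mem_Icc, ← abs_le, abs_div, abs_of_pos h0, div_le_one h0, abs_mul,
          abs_of_pos (by positivity : 0 < 2 * r)]
        exact h3
    refine ⟨(√(axisDistSq x), s, θ), ⟨⟨hρ, Real.sqrt_le_one.2 h2⟩, hs, mem_univ _⟩, ?_⟩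
    ext i
    fin_cases i
    · simp [f, h4]
    · simp [f, h5]
    · simp only [f, Real.sq_sqrt hu0, ← hs']
      simp; field_simp; ring
  · rintro ⟨⟨ρ, s, θ⟩, ⟨⟨h1, h2⟩, hs, -⟩, rfl⟩
    simp only at h1 h2 hs
    have hu : axisDistSq (f (ρ, s, θ)) = ρ ^ 2 := by
      have := Real.sin_sq_add_cos_sq θ
      simp [axisDistSq, f]; linear_combination ρ ^ 2 * this
    refine ⟨by rw [hu]; nlinarith, ?_⟩
    rw [hu]
    have h0 : 0 ≤ ρ ^ 2 - r ^ 2 := by nlinarith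
    have : 2 * r * |(f (ρ, s, θ)) 2 - c| = |s| * (ρ ^ 2 - r ^ 2) := by
      have h3 : (f (ρ, s, θ)) 2 - c = s * (ρ ^ 2 - r ^ 2) / (2 * r) := by simp [f]
      rw [h3, abs_div, abs_mul, abs_of_nonneg h0, abs_of_pos (by positivity : 0 < 2 * r)]
      field_simp
    rw [this]
    nlinarith [abs_le.2 hs]

theorem isConnected_doubleRing {r : ℝ} (hr0 : 0 < r) (hr1 : r < 1) :
    IsConnected (doubleRing r) := by
  refine IsConnected.union ⟨!₂[1, 0, 2 * halfHeight r], ?_, ?_⟩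
    (isConnected_mirrorRing hr0 hr1 _) (isConnected_mirrorRing hr0 hr1 _)
  all_goals
    have hG := halfHeight_pos hr0 hr1
    have h2 := two_mul_halfHeight hr0
    refine ⟨by simp [axisDistSq], ?_⟩
    simp [axisDistSq]
  · rw [show 2 * halfHeight r - halfHeight r = halfHeight r by ring, abs_of_pos hG]; linarith
  · rw [show 2 * halfHeight r - 3 * halfHeight r = -halfHeight r by ring, abs_neg, abs_of_pos hG]
    linarith

/-! ### Surfaces of revolution as smooth patches -/

/-- One half of the surface obtained by revolving the profile curve `s ↦ (R s, Z s)` about the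
vertical axis. A single patch has to be injective up to its edges, so a full turn takes the two
halves `σ = true` and `σ = false`. -/
noncomputable def halfRevolution (σ : Bool) (R Z : ℝ → ℝ) (p : ℝ × ℝ) : E3 :=
  !₂[boolSign σ * (R p.1 * Real.cos (Real.pi * p.2)),
    boolSign σ * (R p.1 * Real.sin (Real.pi * p.2)), Z p.1]

theorem boolSign_ne_zero (b : Bool) : boolSign b ≠ 0 := by
  cases b <;> norm_num [boolSign]

theorem axisDistSq_halfRevolution (σ : Bool) (R Z : ℝ → ℝ) (p : ℝ × ℝ) :
    axisDistSq (halfRevolution σ R Z p) = R p.1 ^ 2 := by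
  have h1 := boolSign_sq σ
  have h2 := Real.sin_sq_add_cos_sq (Real.pi * p.2)
  simp only [axisDistSq, halfRevolution, PiLp.toLp_apply, Matrix.cons_val_zero,
    Matrix.cons_val_one]
  linear_combination R p.1 ^ 2 * h1 + boolSign σ ^ 2 * R p.1 ^ 2 * h2

theorem isSmoothPatch_halfRevolution (σ : Bool) {R Z R' Z' : ℝ → ℝ} (hR : ContDiff ℝ ∞ R)
    (hZ : ContDiff ℝ ∞ Z) (hR' : ∀ s, HasDerivAt R (R' s) s) (hZ' : ∀ s, HasDerivAt Z (Z' s) s)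
    (hpos : ∀ s ∈ Icc (0 : ℝ) 1, 0 < R s)
    (hinj : ∀ s ∈ Icc (0 : ℝ) 1, ∀ t ∈ Icc (0 : ℝ) 1, R s = R t → Z s = Z t → s = t)
    (hreg : ∀ s ∈ Icc (0 : ℝ) 1, R' s ≠ 0 ∨ Z' s ≠ 0) :
    IsSmoothPatch (halfRevolution σ R Z) := by
  have hσ := boolSign_ne_zero σ
  have hpi := Real.pi_pos
  have hsmooth : ContDiff ℝ ∞ (halfRevolution σ R Z) := by
    refine contDiff_euclidean.2 fun i => ?_
    fin_cases i <;> simp [halfRevolution] <;> fun_prop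
  refine ⟨hsmooth, ?_, ?_⟩
  · rintro ⟨s, t⟩ ⟨hs, ht⟩ ⟨s', t'⟩ ⟨hs', ht'⟩ h
    simp only at hs ht hs' ht'
    have hRR : R s = R s' := by
      have h1 := congrArg axisDistSq h
      rw [axisDistSq_halfRevolution, axisDistSq_halfRevolution] at h1
      exact (pow_left_inj₀ (hpos s hs).le (hpos s' hs').le two_ne_zero).1 h1
    have hZZ : Z s = Z s' := by simpa [halfRevolution] using congrArg (fun x : E3 => x 2) h
    obtain rfl := hinj s hs s' hs' hRR hZZ
    have hcos : Real.cos (Real.pi * t) = Real.cos (Real.pi * t') := by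
      simpa [halfRevolution, hσ, (hpos s hs).ne'] using congrArg (fun x : E3 => x 0) h
    have hmem : ∀ u ∈ Icc (0 : ℝ) 1, Real.pi * u ∈ Icc 0 Real.pi := fun u hu =>
      ⟨mul_nonneg hpi.le hu.1, mul_le_of_le_one_right hpi.le hu.2⟩
    have := Real.injOn_cos (hmem t ht) (hmem t' ht') hcos
    rw [mul_left_cancel₀ hpi.ne' this]
  · rintro ⟨s, t⟩ ⟨hs, ht⟩
    simp only at hs ht
    rw [injective_iff_map_eq_zero]
    rintro ⟨a, b⟩ hab
    have hd : HasFDerivAt (halfRevolution σ R Z) (fderiv ℝ (halfRevolution σ R Z) (s, t)) (s, t) :=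
      ((hsmooth.differentiable (by simp)) (s, t)).hasFDerivAt
    have haff : ∀ c d : ℝ, HasDerivAt (fun x : ℝ => c + x * d) d 0 := fun c d => by
      simpa using ((hasDerivAt_id (0 : ℝ)).mul_const d).const_add c
    -- the derivative along the line through `(s, t)` in the direction of the kernel vector
    have hline : HasDerivAt (fun x : ℝ => (s + x * a, t + x * b)) (a, b) 0 :=
      (haff s a).prodMk (haff t b)
    have hcomp : HasDerivAt (fun x : ℝ => halfRevolution σ R Z (s + x * a, t + x * b)) 0 0 := by
      have hd0 : HasFDerivAt (halfRevolution σ R Z) (fderiv ℝ (halfRevolution σ R Z) (s, t))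
          (s + (0 : ℝ) * a, t + (0 : ℝ) * b) := by simpa using hd
      have := hd0.comp_hasDerivAt (0 : ℝ) hline
      rw [hab] at this
      exact this
    have hcoord : ∀ i : Fin 3,
        HasDerivAt (fun x : ℝ => halfRevolution σ R Z (s + x * a, t + x * b) i) 0 0 := fun i => by
      have := ((EuclideanSpace.proj i : E3 →L[ℝ] ℝ).hasFDerivAt).comp_hasDerivAt (0 : ℝ) hcomp
      rw [map_zero] at this
      exact this
    have hs1 : HasDerivAt (fun x : ℝ => s + x * a) a 0 := haff s a
    have ht1 : HasDerivAt (fun x : ℝ => Real.pi * (t + x * b)) (Real.pi * b) 0 :=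
      (haff t b).const_mul _
    have hRc : HasDerivAt (fun x : ℝ => R (s + x * a)) (R' s * a) 0 := by
      have h0 : HasDerivAt R (R' s) (s + 0 * a) := by simpa using hR' s
      exact h0.comp (0 : ℝ) hs1
    have hZc : HasDerivAt (fun x : ℝ => Z (s + x * a)) (Z' s * a) 0 := by
      have h0 : HasDerivAt Z (Z' s) (s + 0 * a) := by simpa using hZ' s
      exact h0.comp (0 : ℝ) hs1
    have e0 := (hcoord 0).unique ((hRc.mul ht1.cos).const_mul (boolSign σ))
    have e1 := (hcoord 1).unique ((hRc.mul ht1.sin).const_mul (boolSign σ))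
    have e2 := (hcoord 2).unique hZc
    simp only [zero_mul, add_zero, zero_eq_mul, hσ, false_or] at e0 e1 e2
    have hsc := Real.sin_sq_add_cos_sq (Real.pi * t)
    set C := Real.cos (Real.pi * t)
    set S := Real.sin (Real.pi * t)
    have hb : b = 0 := by
      have : R s * Real.pi * b = 0 := by
        linear_combination (-R s * Real.pi * b) * hsc - S * e0 + C * e1
      simpa [(hpos s hs).ne', hpi.ne'] using this
    have ha' : R' s * a = 0 := by
      linear_combination (-R' s * a) * hsc + C * e0 + S * e1
    have ha : a = 0 := by
      rcases hreg s hs with h | h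
      · exact (mul_eq_zero.1 ha').resolve_left h
      · exact e2.resolve_left h
    rw [ha, hb]; rfl

/-! ### The boundary of the body -/

/-- Height of the focus of the upper (`b = true`) or lower (`b = false`) ring. -/
noncomputable def focusHeight (r : ℝ) (b : Bool) : ℝ := (2 + boolSign b) * halfHeight r

theorem isFocusHeight_focusHeight (r : ℝ) (b : Bool) : IsFocusHeight r (focusHeight r b) := by
  cases b
  · exact Or.inl (by simp only [focusHeight, boolSign]; norm_num)
  · exact Or.inr (by simp only [focusHeight, boolSign]; norm_num)

theorem IsFocusHeight.exists_eq {r c : ℝ} (hc : IsFocusHeight r c) : ∃ b, c = focusHeight r b := by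
  rcases hc with rfl | rfl
  · exact ⟨false, by simp only [focusHeight, boolSign]; norm_num⟩
  · exact ⟨true, by simp only [focusHeight, boolSign]; norm_num⟩

/-- Radius along the profile curve of a boundary surface of a ring: `some e` stands for the upper
(`e = true`) or lower mirror, `none` for the outer cylindrical wall. -/
noncomputable def profileRadius (r : ℝ) : Option Bool → ℝ → ℝ
  | some _, s => r + (1 - r) * s
  | none, _ => 1

/-- Height along the profile curve of a boundary surface of the ring with focus height `c`. -/
noncomputable def profileHeight (r c : ℝ) : Option Bool → ℝ → ℝ
  | some e, s => c + boolSign e * ((r + (1 - r) * s) ^ 2 - r ^ 2) / (2 * r)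
  | none, s => c + halfHeight r * (2 * s - 1)

/-- The boundary patches of `doubleRing r`. -/
noncomputable def boundaryPatch (r : ℝ) (i : Bool × Bool × Option Bool) : ℝ × ℝ → E3 :=
  halfRevolution i.1 (profileRadius r i.2.2) (profileHeight r (focusHeight r i.2.1) i.2.2)

theorem isSmoothPatch_boundaryPatch {r : ℝ} (hr0 : 0 < r) (hr1 : r < 1)
    (i : Bool × Bool × Option Bool) : IsSmoothPatch (boundaryPatch r i) := by
  have hG := halfHeight_pos hr0 hr1
  obtain ⟨σ, b, _ | e⟩ := i
  · refine isSmoothPatch_halfRevolution σ (R' := fun _ => 0)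
      (Z' := fun _ => halfHeight r * (2 * 1)) ?_ ?_ ?_ ?_ ?_ ?_ ?_
    · unfold profileRadius; fun_prop
    · unfold profileHeight; fun_prop
    · exact fun s => hasDerivAt_const s _
    · exact fun s => ((((hasDerivAt_id s).const_mul 2).sub_const 1).const_mul _).const_add _
    · exact fun s _ => by simp [profileRadius]
    · intro s _ t _ _ h
      simp only [profileHeight] at h
      have : halfHeight r * (s - t) = 0 := by linarith
      simp only [mul_eq_zero, hG.ne', false_or] at this
      linarith
    · exact fun s _ => Or.inr (by simpa using hG.ne')
  · have h1 : ∀ s : ℝ, HasDerivAt (fun s : ℝ => r + (1 - r) * s) (1 - r) s := fun s => by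
      simpa using ((hasDerivAt_id s).const_mul (1 - r)).const_add r
    refine isSmoothPatch_halfRevolution σ (R' := fun _ => 1 - r) (Z' := fun s => boolSign e *
      (((2 : ℕ) : ℝ) * (r + (1 - r) * s) ^ (2 - 1) * (1 - r)) / (2 * r)) ?_ ?_ ?_ ?_ ?_ ?_ ?_
    · unfold profileRadius; fun_prop
    · unfold profileHeight; fun_prop
    · exact h1
    · exact fun s => (((((h1 s).pow 2).sub_const _).const_mul _).div_const _).const_add _
    · intro s hs
      simp only [profileRadius]
      nlinarith [hs.1]
    · intro s _ t _ h _
      simp only [profileRadius] at h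
      have : (1 - r) * (s - t) = 0 := by linarith
      simp only [mul_eq_zero, sub_ne_zero.2 hr1.ne', false_or] at this
      linarith
    · exact fun s _ => Or.inl (sub_ne_zero.2 hr1.ne')

theorem mem_image_boundaryPatch_none_iff {r : ℝ} (hr0 : 0 < r) (hr1 : r < 1) {b : Bool} {x : E3} :
    (∃ σ, x ∈ boundaryPatch r (σ, b, none) '' closedSquare) ↔
      axisDistSq x = 1 ∧ |x 2 - focusHeight r b| ≤ halfHeight r := by
  have hG := halfHeight_pos hr0 hr1
  constructor
  · rintro ⟨σ, ⟨s, t⟩, ⟨hs, -⟩, rfl⟩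
    refine ⟨by simp [boundaryPatch, axisDistSq_halfRevolution, profileRadius], ?_⟩
    simp only at hs
    simp only [boundaryPatch, halfRevolution, profileHeight, PiLp.toLp_apply, Matrix.cons_val]
    rw [abs_le]
    constructor <;> nlinarith [hs.1, hs.2]
  · rintro ⟨h1, h2⟩
    obtain ⟨σ, t, ht, h3, h4⟩ := exists_half_turn_polar one_pos
      (show x 0 ^ 2 + x 1 ^ 2 = 1 ^ 2 by simpa [axisDistSq] using h1)
    obtain ⟨h5, h6⟩ := abs_le.1 h2
    refine ⟨σ, ((x 2 - focusHeight r b) / (2 * halfHeight r) + 1 / 2, t), ⟨⟨?_, ?_⟩, ht⟩, ?_⟩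
    · simp only
      have : -(1 / 2) ≤ (x 2 - focusHeight r b) / (2 * halfHeight r) := by
        rw [le_div_iff₀ (by positivity)]; linarith
      linarith
    · simp only
      have : (x 2 - focusHeight r b) / (2 * halfHeight r) ≤ 1 / 2 := by
        rw [div_le_iff₀ (by positivity)]; linarith
      linarith
    · ext i
      fin_cases i
      · simp [boundaryPatch, halfRevolution, profileRadius, h3]
      · simp [boundaryPatch, halfRevolution, profileRadius, h4]
      · simp [boundaryPatch, halfRevolution, profileHeight]
        field_simp
        ring

theorem mem_image_boundaryPatch_some_iff {r : ℝ} (hr0 : 0 < r) (hr1 : r < 1) {b e : Bool}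
    {x : E3} :
    (∃ σ, x ∈ boundaryPatch r (σ, b, some e) '' closedSquare) ↔
      r ^ 2 ≤ axisDistSq x ∧ axisDistSq x ≤ 1 ∧
        2 * r * (x 2 - focusHeight r b) = boolSign e * (axisDistSq x - r ^ 2) := by
  constructor
  · rintro ⟨σ, ⟨s, t⟩, ⟨hs, -⟩, rfl⟩
    simp only at hs
    have h1 : r ≤ r + (1 - r) * s := by nlinarith [hs.1]
    have h2 : r + (1 - r) * s ≤ 1 := by nlinarith [hs.2]
    rw [boundaryPatch, axisDistSq_halfRevolution]
    simp only [halfRevolution, profileHeight, profileRadius, PiLp.toLp_apply, Matrix.cons_val]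
    refine ⟨by gcongr, by nlinarith, by field_simp; ring⟩
  · rintro ⟨h1, h2, h3⟩
    have hu0 : 0 ≤ axisDistSq x := (sq_nonneg r).trans h1
    have hρ : r ≤ √(axisDistSq x) := Real.le_sqrt_of_sq_le h1
    have hρ1 : √(axisDistSq x) ≤ 1 := Real.sqrt_le_one.2 h2
    have hsq := Real.sq_sqrt hu0
    obtain ⟨σ, t, ht, h4, h5⟩ := exists_half_turn_polar (hr0.trans_le hρ)
      (show x 0 ^ 2 + x 1 ^ 2 = √(axisDistSq x) ^ 2 from hsq.symm)
    have hr1' : 0 < 1 - r := by linarith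
    refine ⟨σ, ((√(axisDistSq x) - r) / (1 - r), t), ⟨⟨?_, ?_⟩, ht⟩, ?_⟩
    · exact div_nonneg (by linarith) hr1'.le
    · exact (div_le_one hr1').2 (by linarith)
    · have hR : r + (1 - r) * ((√(axisDistSq x) - r) / (1 - r)) = √(axisDistSq x) := by
        field_simp; ring
      ext i
      fin_cases i
      · simp [boundaryPatch, halfRevolution, profileRadius, hR, h4]
      · simp [boundaryPatch, halfRevolution, profileRadius, hR, h5]
      · simp only [boundaryPatch, halfRevolution, profileHeight, hR, hsq, ← h3]
        simp
        field_simp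
        ring

theorem frontier_doubleRing {r : ℝ} (hr0 : 0 < r) (hr1 : r < 1) :
    frontier (doubleRing r) = ⋃ i, boundaryPatch r i '' closedSquare := by
  have hG := halfHeight_pos hr0 hr1
  have h2rG := two_mul_halfHeight hr0
  have hunion : ∀ x : E3, x ∈ ⋃ i, boundaryPatch r i '' closedSquare ↔
      ∃ b k, ∃ σ, x ∈ boundaryPatch r (σ, b, k) '' closedSquare := fun x => by
    simp only [mem_iUnion, Prod.exists]
    exact ⟨fun ⟨σ, b, k, h⟩ => ⟨b, k, σ, h⟩, fun ⟨b, k, σ, h⟩ => ⟨σ, b, k, h⟩⟩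
  ext x
  rw [(isClosed_doubleRing r).frontier_eq, hunion, Set.mem_sdiff, mem_interior_doubleRing_iff hr0]
  constructor
  · rintro ⟨h1, h2⟩
    obtain ⟨c, hc, h3⟩ := mem_doubleRing_iff.1 h1
    obtain ⟨b, rfl⟩ := hc.exists_eq
    rcases h3.1.eq_or_lt with h4 | h4
    · exact ⟨b, none, (mem_image_boundaryPatch_none_iff hr0 hr1).2
        ⟨h4, abs_sub_le_of_mem_mirrorRing hr0 h3⟩⟩
    · have h5 : 2 * r * |x 2 - focusHeight r b| = axisDistSq x - r ^ 2 :=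
        h3.2.antisymm (not_lt.1 fun h => h2 ⟨h4, _, hc, h⟩)
      have h6 := sq_le_axisDistSq_of_mem hr0 h3
      rcases abs_cases (x 2 - focusHeight r b) with ⟨h7, -⟩ | ⟨h7, -⟩
      · exact ⟨b, some true, (mem_image_boundaryPatch_some_iff hr0 hr1).2
          ⟨h6, h3.1, by rw [← h5, h7]; simp [boolSign, -neg_sub]⟩⟩
      · exact ⟨b, some false, (mem_image_boundaryPatch_some_iff hr0 hr1).2
          ⟨h6, h3.1, by rw [← h5, h7]; simp [boolSign, -neg_sub]⟩⟩
  · rintro ⟨b, _ | e, h⟩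
    · obtain ⟨h1, h2⟩ := (mem_image_boundaryPatch_none_iff hr0 hr1).1 h
      refine ⟨mirrorRing_subset_doubleRing (isFocusHeight_focusHeight r b) ⟨h1.le, ?_⟩,
        fun h => h.1.ne h1⟩
      rw [h1, ← h2rG]
      gcongr
    · obtain ⟨h1, h2, h3⟩ := (mem_image_boundaryPatch_some_iff hr0 hr1).1 h
      have h4 : 2 * r * |x 2 - focusHeight r b| = axisDistSq x - r ^ 2 := by
        rw [← abs_of_pos (by positivity : 0 < 2 * r), ← abs_mul, h3, abs_mul,
          abs_of_nonneg (sub_nonneg.2 h1)]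
        cases e <;> simp [boolSign]
      have hx : x ∈ mirrorRing r (focusHeight r b) := ⟨h2, h4.le⟩
      refine ⟨mirrorRing_subset_doubleRing (isFocusHeight_focusHeight r b) hx, ?_⟩
      rintro ⟨h5, c, hc, h6⟩
      have h7 : |x 2 - focusHeight r b| < halfHeight r := by
        refine lt_of_mul_lt_mul_left (a := 2 * r) ?_ (by positivity)
        linarith
      -- the other ring is out of reach, so the strict inequality refers to the same focus
      have h8 := (mem_doubleRing_iff_of_abs_lt hr0 hr1 (isFocusHeight_focusHeight r b) h7).1
        (mirrorRing_subset_doubleRing hc ⟨h5.le, h6.le⟩)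
      by_cases hne : focusHeight r b = c
      · rw [← hne] at h6
        linarith
      · have h9 := (isFocusHeight_focusHeight r b).two_mul_le_abs hr0 hr1 hc hne
        have h10 := abs_sub_le_of_mem_mirrorRing hr0
          (show x ∈ mirrorRing r c from ⟨h5.le, h6.le⟩)
        have h11 := abs_sub_le (focusHeight r b) (x 2) c
        rw [abs_sub_comm _ (x 2)] at h11
        linarith

theorem disjoint_boundaryPatch {r : ℝ} (hr0 : 0 < r) (hr1 : r < 1)
    {i j : Bool × Bool × Option Bool} (hij : i ≠ j) :
    Disjoint (boundaryPatch r i '' closedSquare) (boundaryPatch r j '' openSquare) := by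
  have hG := halfHeight_pos hr0 hr1
  have h2rG := two_mul_halfHeight hr0
  rw [Set.disjoint_left]
  rintro x hi hj
  obtain ⟨σ, b, k⟩ := i
  obtain ⟨σ', b', k'⟩ := j
  have hj' : x ∈ boundaryPatch r (σ', b', k') '' closedSquare :=
    image_mono (Set.prod_mono Ioo_subset_Icc_self Ioo_subset_Icc_self) hj
  obtain ⟨⟨s', t'⟩, ⟨hs', ht'⟩, hxj⟩ := hj
  obtain ⟨⟨s, t⟩, ⟨hs, ht⟩, hxi⟩ := id hi
  simp only at hs ht hs' ht'
  -- a point of the interior of a patch is strictly inside the horizontal layer of its ring, so it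
  -- determines the ring, and there it lies on only one of the three surfaces
  have hlayer : |x 2 - focusHeight r b'| < halfHeight r ∧
      (∀ e, k' = some e → r ^ 2 < axisDistSq x ∧ axisDistSq x < 1) := by
    cases k' with
    | none =>
      refine ⟨?_, by simp⟩
      rw [← hxj, abs_lt]
      simp only [boundaryPatch, halfRevolution, profileHeight, PiLp.toLp_apply, Matrix.cons_val]
      constructor <;> nlinarith [hs'.1, hs'.2]
    | some e =>
      have h1 : r < r + (1 - r) * s' := by nlinarith [hs'.1]
      have h2 : r + (1 - r) * s' < 1 := by nlinarith [hs'.2]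
      have hu : axisDistSq x = (r + (1 - r) * s') ^ 2 := by
        rw [← hxj, boundaryPatch, axisDistSq_halfRevolution, profileRadius]
      have hu1 : axisDistSq x < 1 := by rw [hu]; nlinarith
      have hu2 : r ^ 2 < axisDistSq x := by rw [hu]; gcongr
      refine ⟨?_, fun _ _ => ⟨hu2, hu1⟩⟩
      have h3 := ((mem_image_boundaryPatch_some_iff hr0 hr1).1 ⟨_, hj'⟩).2.2
      have h4 : 2 * r * |x 2 - focusHeight r b'| = axisDistSq x - r ^ 2 := by
        rw [← abs_of_pos (by positivity : 0 < 2 * r), ← abs_mul, h3, abs_mul,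
          abs_of_pos (sub_pos.2 hu2)]
        cases e <;> simp [boolSign]
      refine lt_of_mul_lt_mul_left (a := 2 * r) ?_ (by positivity)
      linarith
  obtain ⟨hlayer, hrad⟩ := hlayer
  have hmem : x ∈ mirrorRing r (focusHeight r b) := by
    cases k with
    | none =>
      obtain ⟨h1, h2⟩ := (mem_image_boundaryPatch_none_iff hr0 hr1).1 ⟨_, hi⟩
      exact ⟨h1.le, by rw [h1, ← h2rG]; gcongr⟩
    | some e =>
      obtain ⟨h1, h2, h3⟩ := (mem_image_boundaryPatch_some_iff hr0 hr1).1 ⟨_, hi⟩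
      refine ⟨h2, le_of_eq ?_⟩
      rw [← abs_of_pos (by positivity : 0 < 2 * r), ← abs_mul, h3, abs_mul,
        abs_of_nonneg (sub_nonneg.2 h1)]
      cases e <;> simp [boolSign]
  have hb : b = b' := by
    by_contra hne
    have h1 : focusHeight r b' ≠ focusHeight r b := fun h => hne (by
      have h' : boolSign b' = boolSign b := by
        have := mul_right_cancel₀ hG.ne' h
        linarith
      cases b <;> cases b' <;> first | rfl | (norm_num [boolSign] at h'))
    have h2 := (isFocusHeight_focusHeight r b').two_mul_le_abs hr0 hr1
      (isFocusHeight_focusHeight r b) h1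
    have h3 := abs_sub_le_of_mem_mirrorRing hr0 hmem
    have h4 := abs_sub_le (focusHeight r b') (x 2) (focusHeight r b)
    rw [abs_sub_comm _ (x 2)] at h4
    linarith
  subst hb
  have hk : k = k' := by
    cases k' with
    | none =>
      cases k with
      | none => rfl
      | some e =>
        exfalso
        obtain ⟨h1, -⟩ := (mem_image_boundaryPatch_none_iff hr0 hr1).1 ⟨_, hj'⟩
        obtain ⟨-, -, h3⟩ := (mem_image_boundaryPatch_some_iff hr0 hr1).1 ⟨_, hi⟩
        rw [h1] at h3
        have h4 : 2 * r * |x 2 - focusHeight r b| = 1 - r ^ 2 := by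
          rw [← abs_of_pos (by positivity : 0 < 2 * r), ← abs_mul, h3, abs_mul,
            abs_of_pos (by nlinarith : 0 < 1 - r ^ 2)]
          cases e <;> simp [boolSign]
        nlinarith
    | some e' =>
      obtain ⟨hu1, hu2⟩ := hrad e' rfl
      cases k with
      | none => exact absurd ((mem_image_boundaryPatch_none_iff hr0 hr1).1 ⟨_, hi⟩).1 hu2.ne
      | some e =>
        obtain ⟨-, -, h3⟩ := (mem_image_boundaryPatch_some_iff hr0 hr1).1 ⟨_, hi⟩
        obtain ⟨-, -, h4⟩ := (mem_image_boundaryPatch_some_iff hr0 hr1).1 ⟨_, hj'⟩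
        have h5 : boolSign e = boolSign e' :=
          mul_right_cancel₀ (sub_pos.2 hu1).ne' (h3.symm.trans h4)
        cases e <;> cases e' <;> first | rfl | (norm_num [boolSign] at h5)
  subst hk
  -- the two halves of one surface of revolution are told apart by the sign of the coordinate `x 1`
  have hRpos : ∀ s ∈ Icc (0 : ℝ) 1, 0 < profileRadius r k s := by
    intro s hs
    cases k with
    | none => exact one_pos
    | some e => simp only [profileRadius]; nlinarith [hs.1]
  have hpi := Real.pi_pos
  have hs0 : 0 ≤ Real.sin (Real.pi * t) := Real.sin_nonneg_of_nonneg_of_le_pi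
    (mul_nonneg hpi.le ht.1) (mul_le_of_le_one_right hpi.le ht.2)
  have hs1 : 0 < Real.sin (Real.pi * t') := Real.sin_pos_of_pos_of_lt_pi
    (mul_pos hpi ht'.1) (mul_lt_of_lt_one_right hpi ht'.2)
  have h1 : boolSign σ * (profileRadius r k s * Real.sin (Real.pi * t)) =
      boolSign σ' * (profileRadius r k s' * Real.sin (Real.pi * t')) := by
    simpa [boundaryPatch, halfRevolution] using congrArg (fun x : E3 => x 1) (hxi.trans hxj.symm)
  have h2 := mul_nonneg (hRpos s hs).le hs0
  have h3 := mul_pos (hRpos s' ⟨hs'.1.le, hs'.2.le⟩) hs1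
  apply hij
  cases σ <;> cases σ' <;> first | rfl | (simp [boolSign] at h1; linarith)

theorem isBody_doubleRing {r : ℝ} (hr0 : 0 < r) (hr1 : r < 1) : IsBody (doubleRing r) where
  bounded := isBounded_doubleRing hr0
  connected := isConnected_doubleRing hr0 hr1
  solid := closure_interior_doubleRing hr0 hr1
  boundary := ⟨Bool × Bool × Option Bool, inferInstance, boundaryPatch r,
    isSmoothPatch_boundaryPatch hr0 hr1, frontier_doubleRing hr0 hr1,
    fun _ _ hij => disjoint_boundaryPatch hr0 hr1 hij⟩

/-! ### The billiard trajectories -/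

/-- The downward vertical direction. -/
noncomputable def downward : E3 := !₂[0, 0, -1]

/-- Away from their edges the mirrors are smooth, and the gradient of
`2 r e (z - c) - ρ² + r²` gives the normal. -/
theorem isOutwardNormal_mirror {r c e : ℝ} (hr0 : 0 < r) (hr1 : r < 1) (hc : IsFocusHeight r c)
    (he : e ^ 2 = 1) {p : E3} (hp1 : r ^ 2 < axisDistSq p) (hp2 : axisDistSq p < 1)
    (hp : 2 * r * (e * (p 2 - c)) = axisDistSq p - r ^ 2) :
    IsOutwardNormal (doubleRing r) p
      ((√(axisDistSq p + r ^ 2))⁻¹ • !₂[-p 0, -p 1, e * r]) := by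
  have h2rG := two_mul_halfHeight hr0
  have hcont := continuous_axisDistSq
  have hN : 0 < axisDistSq p + r ^ 2 := by nlinarith [sq_nonneg r]
  set N := √(axisDistSq p + r ^ 2) with hN_def
  have hN0 : 0 < N := Real.sqrt_pos.2 hN
  have hN2 : N ^ 2 = axisDistSq p + r ^ 2 := Real.sq_sqrt hN.le
  have hp0 : 0 < e * (p 2 - c) := by
    refine pos_of_mul_pos_right (a := 2 * r) ?_ (by positivity)
    linarith
  have habs : ∀ y : E3, 0 < e * (y 2 - c) → |y 2 - c| = e * (y 2 - c) := fun y hy => by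
    rw [← abs_of_pos hy, abs_mul]
    have : |e| = 1 := by rw [← sq_eq_sq₀ (abs_nonneg e) one_pos.le, sq_abs, he, one_pow]
    rw [this, one_mul]
  refine ⟨?_, {y | |y 2 - c| < halfHeight r} ∩ ({y | axisDistSq y < 1} ∩ {y | 0 < e * (y 2 - c)}),
    fun y => (2 * N)⁻¹ * (2 * r * (e * (y 2 - c)) - y 0 ^ 2 - y 1 ^ 2 + r ^ 2),
    ?_, ⟨?_, hp2, hp0⟩, ?_, ?_, ?_, ?_⟩
  · rw [norm_smul, Real.norm_eq_abs, abs_of_pos (inv_pos.2 hN0)]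
    have : ‖(!₂[-p 0, -p 1, e * r] : E3)‖ = N := by
      rw [EuclideanSpace.norm_eq, Fin.sum_univ_three, hN_def]
      simp [axisDistSq, mul_pow, sq_abs, he]
    rw [this, inv_mul_cancel₀ hN0.ne']
  · exact (isOpen_lt (f := fun y : E3 => |y 2 - c|) (by fun_prop) continuous_const).inter
      ((isOpen_lt hcont continuous_const).inter
        (isOpen_lt (g := fun y : E3 => e * (y 2 - c)) continuous_const (by fun_prop)))
  · simp only [Set.mem_ofPred_eq]
    rw [habs p hp0]
    refine lt_of_mul_lt_mul_left (a := 2 * r) ?_ (by positivity)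
    linarith
  · fun_prop
  · simp only [axisDistSq] at hp ⊢
    rw [hp]; ring
  · rw [hasGradientAt_iff_hasFDerivAt]
    have hproj : ∀ i : Fin 3, HasFDerivAt (fun y : E3 => y i) (EuclideanSpace.proj i : E3 →L[ℝ] ℝ) p
      := fun i => (EuclideanSpace.proj i : E3 →L[ℝ] ℝ).hasFDerivAt
    have h := ((((((hproj 2).sub_const c).const_mul e).const_mul (2 * r)).sub
      ((hproj 0).pow 2)).sub ((hproj 1).pow 2)).add_const (r ^ 2) |>.const_mul (2 * N)⁻¹
    refine h.congr_fderiv ?_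
    ext w
    rw [InnerProductSpace.toDual_apply_apply, inner_smul_left]
    simp [PiLp.inner_apply, Fin.sum_univ_three]
    field_simp
    ring
  · rintro y ⟨hy1, hy2, hy3⟩
    rw [mem_doubleRing_iff_of_abs_lt hr0 hr1 hc hy1]
    have h1 : 0 < (2 * N)⁻¹ := by positivity
    have h2 : (2 * N)⁻¹ * (2 * r * (e * (y 2 - c)) - y 0 ^ 2 - y 1 ^ 2 + r ^ 2) ≤ 0 ↔
        2 * r * (e * (y 2 - c)) - y 0 ^ 2 - y 1 ^ 2 + r ^ 2 ≤ 0 :=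
      ⟨fun h => nonpos_of_mul_nonpos_right h h1, fun h => mul_nonpos_of_nonneg_of_nonpos h1.le h⟩
    simp only [h2]
    constructor
    · rintro ⟨-, h⟩
      rw [habs y hy3] at h
      simp only [axisDistSq] at h
      linarith
    · intro h
      refine ⟨le_of_lt hy2, ?_⟩
      rw [habs y hy3]
      simp only [axisDistSq]
      linarith

/-- The velocity of a particle on its way from the upper mirror, which it hits at a point above
`(x 0, x 1)`, through the focus to the lower mirror. -/
noncomputable def focalVel (r : ℝ) (x : E3) : E3 :=
  (axisDistSq x + r ^ 2)⁻¹ • !₂[-(2 * r * x 0), -(2 * r * x 1), r ^ 2 - axisDistSq x]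

theorem inner_downward_normal (a b d m : ℝ) :
    inner ℝ downward (m⁻¹ • !₂[a, b, d] : E3) = -(d / m) := by
  simp [downward, PiLp.inner_apply, Fin.sum_univ_three]
  ring

theorem reflectVel_downward {r : ℝ} (hr0 : 0 < r) (x : E3) :
    reflectVel ((√(axisDistSq x + r ^ 2))⁻¹ • !₂[-x 0, -x 1, 1 * r]) downward = focalVel r x := by
  have hN : 0 < axisDistSq x + r ^ 2 := by
    have : 0 ≤ axisDistSq x := by unfold axisDistSq; positivity
    positivity
  have hN2 := Real.sq_sqrt hN.le
  have hN0 := Real.sqrt_pos.2 hN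
  rw [reflectVel, inner_downward_normal]
  generalize √(axisDistSq x + r ^ 2) = N at *
  rw [focalVel, ← hN2]
  ext i
  fin_cases i
  · simp [downward]; field_simp
  · simp [downward]; field_simp
  · simp [downward]; field_simp; linarith

theorem inner_focalVel_normal {r : ℝ} (hr0 : 0 < r) (x : E3) :
    inner ℝ (focalVel r x) ((√(axisDistSq x + r ^ 2))⁻¹ • !₂[x 0, x 1, -1 * r] : E3) =
      -(r / √(axisDistSq x + r ^ 2)) := by
  have hN : 0 < axisDistSq x + r ^ 2 := by
    have : 0 ≤ axisDistSq x := by unfold axisDistSq; positivity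
    positivity
  have hN0 := Real.sqrt_pos.2 hN
  simp [focalVel, PiLp.inner_apply, Fin.sum_univ_three]
  field_simp
  simp only [axisDistSq]
  ring

theorem reflectVel_focalVel {r : ℝ} (hr0 : 0 < r) (x : E3) :
    reflectVel ((√(axisDistSq x + r ^ 2))⁻¹ • !₂[x 0, x 1, -1 * r]) (focalVel r x) = downward := by
  have hN : 0 < axisDistSq x + r ^ 2 := by
    have : 0 ≤ axisDistSq x := by unfold axisDistSq; positivity
    positivity
  have hN2 := Real.sq_sqrt hN.le
  have hN0 := Real.sqrt_pos.2 hN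
  rw [reflectVel, inner_focalVel_normal hr0]
  generalize √(axisDistSq x + r ^ 2) = N at *
  rw [focalVel, ← hN2]
  ext i
  fin_cases i
  · simp [downward]; field_simp; ring
  · simp [downward]; field_simp; ring
  · simp [downward]; field_simp; linarith

/-- The open segment between antipodal points of the two mirrors of a ring, which is parametrized by
`l` and passes through the focus for `l = 0`, does not meet the body. -/
theorem focal_chord_notMem {r c : ℝ} (hr0 : 0 < r) (hr1 : r < 1) (hc : IsFocusHeight r c)
    {x : E3} (hx1 : r ^ 2 < axisDistSq x) (hx2 : axisDistSq x < 1) {l : ℝ} (hl : |l| < 1) :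
    !₂[l * x 0, l * x 1, c + l * ((axisDistSq x - r ^ 2) / (2 * r))] ∉ doubleRing r := by
  have h2rG := two_mul_halfHeight hr0
  set u := axisDistSq x with hu
  have hl0 := abs_nonneg l
  have hz : 2 * r * |l * ((u - r ^ 2) / (2 * r))| = |l| * (u - r ^ 2) := by
    rw [abs_mul, abs_div, abs_of_pos (sub_pos.2 hx1), abs_of_pos (by positivity : 0 < 2 * r)]
    field_simp
  have hlt : |l * ((u - r ^ 2) / (2 * r))| < halfHeight r := by
    refine lt_of_mul_lt_mul_left (a := 2 * r) ?_ (by positivity)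
    rw [hz]; nlinarith
  have hu' : axisDistSq !₂[l * x 0, l * x 1, c + l * ((u - r ^ 2) / (2 * r))] = |l| ^ 2 * u := by
    rw [sq_abs, hu]; simp [axisDistSq]; ring
  rw [mem_doubleRing_iff_of_abs_lt hr0 hr1 hc (by simpa using hlt)]
  rintro ⟨-, h⟩
  rw [hu'] at h
  have h' : 2 * r * |l * ((u - r ^ 2) / (2 * r))| ≤ |l| ^ 2 * u - r ^ 2 := by simpa using h
  rw [hz] at h'
  -- `a (u - r²) ≤ a² u - r²` amounts to `(1 - a) (a u + r²) ≤ 0`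
  have h3 : 0 < (1 - |l|) * (|l| * u + r ^ 2) := by
    have : 0 < r ^ 2 := by positivity
    have : 0 ≤ |l| * u := mul_nonneg hl0 (by linarith)
    have : 0 < 1 - |l| := by linarith
    positivity
  nlinarith

/-- A vertical particle that reaches the upper mirror of a ring passes through the focus, is made
vertical again by the lower mirror, and leaves the ring along the line obtained by the half turn
about the axis. The shift by `2 * r` is the length of the detour. -/
theorem FinalMotion.cross_ring {r c : ℝ} (hr0 : 0 < r) (hr1 : r < 1) (hc : IsFocusHeight r c)
    {a : WithBot ℝ} {x x' v' : E3} {τ : ℝ} (hx1 : r ^ 2 < axisDistSq x) (hx2 : axisDistSq x < 1)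
    (ha : a < (τ : WithBot ℝ)) (hτ : x 2 - τ = c + (axisDistSq x - r ^ 2) / (2 * r))
    (hfree : ∀ t : ℝ, a < (t : WithBot ℝ) → t < τ → x + t • downward ∉ doubleRing r)
    (hnext : FinalMotion (doubleRing r) ((τ + (axisDistSq x + r ^ 2) / r : ℝ) : WithBot ℝ)
      !₂[-x 0, -x 1, x 2 + 2 * r] downward x' v') :
    FinalMotion (doubleRing r) a x downward x' v' := by
  set u := axisDistSq x with hu
  have hN : 0 < u + r ^ 2 := by nlinarith [sq_nonneg r]
  have hN0 := Real.sqrt_pos.2 hN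
  -- the two points of reflection
  have hp : x + τ • downward = !₂[x 0, x 1, c + (u - r ^ 2) / (2 * r)] := by
    ext i
    fin_cases i
    · simp [downward]
    · simp [downward]
    · simp [downward]; linarith
  have hup : axisDistSq (x + τ • downward) = u := by rw [hp]; simp [axisDistSq, hu]
  set q : E3 := !₂[-x 0, -x 1, c - (u - r ^ 2) / (2 * r)] with hq
  have huq : axisDistSq q = u := by simp [axisDistSq, hu, hq]
  have hchord : ∀ s : ℝ, x + τ • downward - τ • focalVel r x + s • focalVel r x =
      !₂[(1 - (s - τ) * (2 * r / (u + r ^ 2))) * x 0, (1 - (s - τ) * (2 * r / (u + r ^ 2))) * x 1,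
        c + (1 - (s - τ) * (2 * r / (u + r ^ 2))) * ((u - r ^ 2) / (2 * r))] := by
    intro s
    rw [hp, focalVel, ← hu]
    ext i
    fin_cases i
    · simp; field_simp; ring
    · simp; field_simp; ring
    · simp; field_simp; ring
  have hn1 := isOutwardNormal_mirror hr0 hr1 hc (one_pow 2) (p := x + τ • downward)
    (by rwa [hup]) (by rwa [hup]) (by rw [hup, hp]; simp; field_simp)
  have hn2 := isOutwardNormal_mirror hr0 hr1 hc (e := -1) (by norm_num) (p := q)
    (by rwa [huq]) (by rwa [huq]) (by rw [huq]; simp [hq]; field_simp)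
  have hcoord : (x + τ • downward) 0 = x 0 ∧ (x + τ • downward) 1 = x 1 := by
    rw [hp]; simp
  rw [hup, hcoord.1, hcoord.2] at hn1
  rw [huq, show -q 0 = x 0 by simp [hq], show -q 1 = x 1 by simp [hq]] at hn2
  refine FinalMotion.reflect a x downward x' v' τ _ ha hfree hn1 ?_ ?_
  · rw [inner_downward_normal]
    have : 0 < 1 * r / √(u + r ^ 2) := by positivity
    linarith
  rw [hu, reflectVel_downward hr0]
  have hend : x + τ • downward - τ • focalVel r x + (τ + (u + r ^ 2) / r) • focalVel r x = q := by
    rw [hchord, hq]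
    have : (1 : ℝ) - (τ + (u + r ^ 2) / r - τ) * (2 * r / (u + r ^ 2)) = -1 := by
      field_simp; ring
    rw [this]
    ext i
    fin_cases i
    · simp
    · simp
    · simp; ring
  refine FinalMotion.reflect _ _ (focalVel r x) x' v' (τ + (u + r ^ 2) / r)
    ((√(u + r ^ 2))⁻¹ • !₂[x 0, x 1, -1 * r]) ?_ ?_ ?_ ?_ ?_
  · rw [WithBot.coe_lt_coe]
    have : 0 < (u + r ^ 2) / r := by positivity
    linarith
  · intro t ht1 ht2
    rw [WithBot.coe_lt_coe] at ht1
    rw [hchord]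
    refine focal_chord_notMem hr0 hr1 hc hx1 hx2 ?_
    have h1 : 0 < (t - τ) * (2 * r / (u + r ^ 2)) := mul_pos (by linarith) (by positivity)
    have h2 : (t - τ) * (2 * r / (u + r ^ 2)) < 2 := by
      have h3 : (t - τ) < (u + r ^ 2) / r := by linarith
      calc (t - τ) * (2 * r / (u + r ^ 2)) < (u + r ^ 2) / r * (2 * r / (u + r ^ 2)) := by gcongr
        _ = 2 := by field_simp
    rw [abs_lt]; constructor <;> linarith
  · rw [hend]; exact hn2
  · rw [hu, inner_focalVel_normal hr0, ← hu]
    have : 0 < r / √(u + r ^ 2) := by positivity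
    linarith
  · rw [hend, hu, reflectVel_focalVel hr0, ← hu]
    convert hnext using 1
    ext i
    fin_cases i
    · simp [downward, hq]
    · simp [downward, hq]
    · simp [downward, hq]; field_simp; field_simp at hτ; linarith

theorem axisDistSq_add_smul_downward (x : E3) (t : ℝ) :
    axisDistSq (x + t • downward) = axisDistSq x := by
  simp [axisDistSq, downward]

theorem add_smul_downward_two (x : E3) (t : ℝ) : (x + t • downward) 2 = x 2 - t := by
  simp [downward]; ring

/-- A vertical line meets a ring in a vertical segment between the mirrors. -/
theorem add_smul_downward_mem_iff {r : ℝ} (hr0 : 0 < r) {x : E3} (t : ℝ)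
    (hx2 : axisDistSq x < 1) : x + t • downward ∈ doubleRing r ↔ ∃ c, IsFocusHeight r c ∧
      |x 2 - t - c| ≤ (axisDistSq x - r ^ 2) / (2 * r) := by
  rw [mem_doubleRing_iff]
  refine exists_congr fun c => and_congr_right fun _ => ?_
  rw [mirrorRing, Set.mem_ofPred_eq, axisDistSq_add_smul_downward, add_smul_downward_two,
    le_div_iff₀ (by positivity), mul_comm (2 * r)]
  exact ⟨fun h => h.2, fun h => ⟨hx2.le, h⟩⟩

/-- The two rings in succession turn the trajectory twice by half a turn about the axis. -/
theorem scatters_of_lt_of_lt {r : ℝ} (hr0 : 0 < r) (hr1 : r < 1) {x : E3}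
    (hx1 : r ^ 2 < axisDistSq x) (hx2 : axisDistSq x < 1) :
    Scatters (doubleRing r) x downward (x - (4 * r) • downward) downward := by
  have h2rG := two_mul_halfHeight hr0
  have hG := halfHeight_pos hr0 hr1
  set u := axisDistSq x with hu
  -- half the length of the segment in which a vertical line above `(x 0, x 1)` meets a ring
  set d := (u - r ^ 2) / (2 * r) with hd
  have hd0 : 0 < d := div_pos (by linarith) (by positivity)
  have hdG : d < halfHeight r := by
    rw [hd, div_lt_iff₀ (by positivity)]; linarith
  have hN : (u + r ^ 2) / r = 2 * d + 2 * r := by rw [hd]; field_simp; ring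
  set y : E3 := !₂[-x 0, -x 1, x 2 + 2 * r] with hy
  have huy : axisDistSq y = u := by simp [hy, axisDistSq, hu]
  have hy2 : y 2 = x 2 + 2 * r := by simp [hy]
  have hz : (!₂[-y 0, -y 1, y 2 + 2 * r] : E3) = x - (4 * r) • downward := by
    ext i
    fin_cases i
    · simp [hy, downward]
    · simp [hy, downward]
    · simp [hy, downward]; ring
  refine FinalMotion.cross_ring (c := 3 * halfHeight r) (τ := x 2 - 3 * halfHeight r - d)
    hr0 hr1 (Or.inr rfl) hx1 hx2 (WithBot.bot_lt_coe _) (by rw [← hu, ← hd]; ring) ?_ ?_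
  · intro t _ ht
    rw [add_smul_downward_mem_iff hr0 t hx2, ← hu, ← hd]
    rintro ⟨c, rfl | rfl, h⟩ <;> linarith [(abs_le.1 h).2]
  rw [← hu, ← hy, hN]
  refine FinalMotion.cross_ring (c := halfHeight r) (τ := y 2 - halfHeight r - d)
    hr0 hr1 (Or.inl rfl) (by rwa [huy]) (by rwa [huy]) ?_ (by rw [huy, ← hd]; ring) ?_ ?_
  · rw [WithBot.coe_lt_coe, hy2]; linarith
  · intro t ht1 ht2
    rw [WithBot.coe_lt_coe] at ht1
    rw [add_smul_downward_mem_iff hr0 t (by rwa [huy]), huy, ← hd]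
    rintro ⟨c, rfl | rfl, h⟩
    · linarith [(abs_le.1 h).2]
    · linarith [(abs_le.1 h).1]
  · rw [hz, huy, hN]
    refine FinalMotion.free _ _ _ fun t ht => ?_
    rw [WithBot.coe_lt_coe] at ht
    have hu4 : axisDistSq (x - (4 * r) • downward) = u := by
      rw [sub_eq_add_neg, ← neg_smul, axisDistSq_add_smul_downward]
    have hz4 : (x - (4 * r) • downward) 2 = x 2 + 4 * r := by
      rw [sub_eq_add_neg, ← neg_smul, add_smul_downward_two]; ring
    rw [add_smul_downward_mem_iff hr0 t (by rwa [hu4]), hu4, hz4, ← hd]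
    rintro ⟨c, rfl | rfl, h⟩ <;> linarith [(abs_le.1 h).1]

theorem exists_scatters {r : ℝ} (hr0 : 0 < r) (hr1 : r < 1) {x : E3}
    (hx1 : axisDistSq x ≠ r ^ 2) (hx2 : axisDistSq x ≠ 1) :
    ∃ d : ℝ, Scatters (doubleRing r) x downward (x + d • downward) downward := by
  have hout : (∀ t : ℝ, x + t • downward ∉ doubleRing r) →
      ∃ d : ℝ, Scatters (doubleRing r) x downward (x + d • downward) downward := fun h =>
    ⟨0, by simpa [Scatters] using FinalMotion.free ⊥ x downward fun t _ => h t⟩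
  rcases hx1.lt_or_gt with h1 | h1
  · refine hout fun t ht => h1.not_ge ?_
    simpa [axisDistSq_add_smul_downward] using sq_le_axisDistSq_of_mem_doubleRing hr0 ht
  rcases hx2.lt_or_gt with h2 | h2
  · exact ⟨-(4 * r), by simpa [sub_eq_add_neg] using scatters_of_lt_of_lt hr0 hr1 h1 h2⟩
  · refine hout fun t ht => h2.not_ge ?_
    simpa [axisDistSq_add_smul_downward] using axisDistSq_le_one_of_mem ht

/-! ### The exceptional cylinders -/

/-- The preimage of a sphere under a linear map is part of the frontier of a convex set. -/
theorem addHaar_preimage_sphere {E F : Type*} [NormedAddCommGroup E] [NormedSpace ℝ E]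
    [MeasurableSpace E] [BorelSpace E] [FiniteDimensional ℝ E] [NormedAddCommGroup F]
    [NormedSpace ℝ F] (μ : Measure E) [μ.IsAddHaarMeasure] (L : E →L[ℝ] F) {k : ℝ} (hk : 0 < k) :
    μ {x | ‖L x‖ = k} = 0 := by
  have hconv : Convex ℝ (L ⁻¹' Metric.closedBall 0 k) :=
    (convex_closedBall 0 k).linear_preimage L.toLinearMap
  refine measure_mono_null (fun x hx => ?_) (hconv.addHaar_frontier μ)
  have hx' : ‖L x‖ = k := hx
  refine ⟨subset_closure (by simp [hx']), fun hint => ?_⟩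
  have ht : Tendsto (fun s : ℝ => s • x) (𝓝[>] 1) (𝓝 x) := by
    have h : Continuous fun s : ℝ => s • x := by fun_prop
    simpa using (h.tendsto 1).mono_left (nhdsWithin_le_nhds (s := Ioi 1))
  obtain ⟨s, hs1, hs2⟩ :=
    ((ht.eventually (isOpen_interior.mem_nhds hint)).and self_mem_nhdsWithin).exists
  have h1 : ‖L (s • x)‖ ≤ k := by simpa using interior_subset hs1
  have h2 : (1 : ℝ) < s := hs2
  rw [map_smul, norm_smul, hx', Real.norm_eq_abs, abs_of_pos (by linarith)] at h1
  nlinarith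

/-- The horizontal projection of space onto the plane. -/
noncomputable def horizontalProj : E3 →L[ℝ] E2 :=
  LinearMap.toContinuousLinearMap
    { toFun := fun x => !₂[x 0, x 1]
      map_add' := fun x y => by ext i; fin_cases i <;> simp
      map_smul' := fun a x => by ext i; fin_cases i <;> simp }

theorem norm_horizontalProj (x : E3) : ‖horizontalProj x‖ = √(axisDistSq x) := by
  rw [EuclideanSpace.norm_eq, Fin.sum_univ_two]
  simp [horizontalProj, axisDistSq]

theorem ae_axisDistSq_ne {E : Type*} [NormedAddCommGroup E] [NormedSpace ℝ E]
    [MeasurableSpace E] [BorelSpace E] [FiniteDimensional ℝ E] (μ : Measure E)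
    [μ.IsAddHaarMeasure] (i : E →L[ℝ] E3) {k : ℝ} (hk : 0 < k) :
    ∀ᵐ x ∂μ, axisDistSq (i x) ≠ k := by
  rw [ae_iff]
  refine measure_mono_null (fun x hx => ?_)
    (addHaar_preimage_sphere μ (horizontalProj.comp i) (Real.sqrt_pos.2 hk))
  have hx' : axisDistSq (i x) = k := by simpa using hx
  simp [norm_horizontalProj, hx']

theorem norm_downward : ‖downward‖ = 1 := by
  simp [downward, EuclideanSpace.norm_eq, Fin.sum_univ_three]

theorem perpPart_add_smul_downward (x : (ℝ ∙ downward)ᗮ) (d : ℝ) :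
    perpPart ((x : E3) + d • downward) downward = x := by
  have h : inner ℝ (x : E3) downward = 0 := by
    rw [real_inner_comm]; exact Submodule.mem_orthogonal_singleton_iff_inner_right.1 x.2
  rw [perpPart, inner_add_left, h, inner_smul_left, real_inner_self_eq_norm_sq, norm_downward]
  simp

theorem isInvisible_doubleRing {r : ℝ} (hr0 : 0 < r) (hr1 : r < 1) :
    IsInvisible (doubleRing r) downward := by
  have hr2 : 0 < r ^ 2 := by positivity
  have hplane : ∀ᵐ x : (ℝ ∙ downward)ᗮ, ∃ x' v',
      Scatters (doubleRing r) (x : E3) downward x' v' ∧ perpPart x' v' = (x : E3) := by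
    filter_upwards [ae_axisDistSq_ne volume (ℝ ∙ downward)ᗮ.subtypeL hr2,
      ae_axisDistSq_ne volume (ℝ ∙ downward)ᗮ.subtypeL one_pos] with x h1 h2
    obtain ⟨d, hd⟩ := exists_scatters hr0 hr1 h1 h2
    exact ⟨_, _, hd, perpPart_add_smul_downward x d⟩
  refine ⟨⟨?_, id, MeasurePreserving.id volume, hplane⟩, hplane⟩
  filter_upwards [ae_axisDistSq_ne volume (.id ℝ E3) hr2,
    ae_axisDistSq_ne volume (.id ℝ E3) one_pos] with x h1 h2
  obtain ⟨d, hd⟩ := exists_scatters hr0 hr1 h1 h2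
  exact ⟨_, _, hd, rfl⟩

theorem theorem2 (r : ℝ) (hr0 : 0 < r) (hr1 : r < 1) :
    ∃ h₀ : ℝ, ∀ h : ℝ, h₀ ≤ h →
      ∃ B : Set E3, IsBody B ∧ IsInscribed (planarRing r) h B ∧ IsInvisible B !₂[0, 0, -1] :=
  ⟨4 * halfHeight r, fun _ hh => ⟨doubleRing r, isBody_doubleRing hr0 hr1,
    isInscribed_doubleRing hr0 hr1 hh, isInvisible_doubleRing hr0 hr1⟩⟩
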